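/- For $z=(x,\omega)\in\mathbb R^2$ let $\pi(z)f(t)=e^{2\pi i\omega t}f(t-x)$ on $L^2(\mathbb R)$. Let $S_0(\mathbb R)$ be Feichtinger's algebra, i.e. the space of all $f\in L^2(\mathbb R)$ whose short-time Fourier transform $(x,\omega)\mapsto\int_{\mathbb R} f(t)e^{-\pi(t-x)^2}e^{-2\pi i\omega t}\,dt$ is integrable on $\mathbb R^2$. Let $\mathcal A_1^1=\{\sum_{k,l\in\mathbb Z}a_{kl}\pi(k,l): (a_{kl})\in\ell^1(\mathbb Z^2)\}$, an algebra of operators on $L^2(\mathbb R)$ (a copy of the Wiener algebra $A(\mathbb T^2)$ of absolutely convergent Fourier series), which acts on $S_0(\mathbb R)$. Write $(\nabla_1f)(t)=2\pi i\,t\,f(t)$ and $\nabla_2f=f'$, the derivative being taken in the sense of distributions. **Theorem.** Let $g\in S_0(\mathbb R)$ be a generator of the $\mathcal A_1^1$-module $S_0(\mathbb R)$, i.e. every $f\in S_0(\mathbb R)$ is of the form $f=\sum_{k,l}a_{kl}\pi(k,l)g$ with $(a_{kl})\in\ell^1(\mathbb Z^2)$. Suppose that the Gabor system $\{\pi(k,l)g:k,l\in\mathbb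 Z\}$ is a Riesz basis for $L^2(\mathbb R)$, and let $h=S^{-1}g$ be the canonical dual atom, where $Sf=\sum_{k,l}\langle f,\pi(k,l)g\rangle\,\pi(k,l)g$ is the frame operator of this system. Then $\nabla_1g\notin S_0(\mathbb R)$ or $\nabla_2h\notin S_0(\mathbb R)$. -/

import Mathlib

open MeasureTheory

open scoped ENNReal ContDiff

noncomputable section

namespace BalianLow

/-- The Hilbert space `L²(ℝ)` of complex-valued square-integrable functions. -/
abbrev L2 : Type := Lp ℂ 2 (volume : Measure ℝ)

/-- The function `t ↦ e^{2π i ω t} f(t - x)`, for `z = (x, ω)`. -/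
def shiftFun (z : ℝ × ℝ) (f : ℝ → ℂ) (t : ℝ) : ℂ :=
  Complex.exp (2 * Real.pi * Complex.I * z.2 * t) * f (t - z.1)

theorem norm_shiftFun (z : ℝ × ℝ) (f : ℝ → ℂ) (t : ℝ) :
    ‖shiftFun z f t‖ = ‖f (t - z.1)‖ := by
  have h : (2 * Real.pi * Complex.I * z.2 * t : ℂ)
      = ((2 * Real.pi * z.2 * t : ℝ) : ℂ) * Complex.I := by
    push_cast; ring
  rw [shiftFun, norm_mul, h, Complex.norm_exp_ofReal_mul_I, one_mul]

theorem memLp_shiftFun (z : ℝ × ℝ) {f : ℝ → ℂ} (hf : MemLp f 2 volume) :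
    MemLp (shiftFun z f) 2 volume := by
  have h1 : MemLp (fun t => f (t - z.1)) 2 volume :=
    hf.comp_measurePreserving (measurePreserving_sub_right volume z.1)
  refine h1.congr_norm ?_ (Filter.Eventually.of_forall fun t => (norm_shiftFun z f t).symm)
  exact AEStronglyMeasurable.mul
    (Continuous.aestronglyMeasurable (by fun_prop)) h1.aestronglyMeasurable

theorem shiftFun_congr (z : ℝ × ℝ) {f f' : ℝ → ℂ} (h : f =ᵐ[volume] f') :
    shiftFun z f =ᵐ[volume] shiftFun z f' := by
  have h1 := (measurePreserving_sub_right (volume : Measure ℝ) z.1).quasiMeasurePreserving.ae_eq_comp h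
  filter_upwards [h1] with t ht
  simp only [Function.comp_apply] at ht
  simp only [shiftFun, ht]

/-- The time-frequency shift `π(z)`, `z = (x, ω)`, as a linear isometry of `L²(ℝ)`. -/
def tfShift (z : ℝ × ℝ) : L2 →ₗᵢ[ℂ] L2 where
  toFun f := (memLp_shiftFun z (Lp.memLp f)).toLp (shiftFun z f)
  map_add' f g := by
    rw [← MemLp.toLp_add]
    refine MemLp.toLp_congr _ _ ((shiftFun_congr z (Lp.coeFn_add f g)).trans ?_)
    refine Filter.Eventually.of_forall fun t => ?_
    simp only [shiftFun, Pi.add_apply, mul_add]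
  map_smul' c f := by
    simp only [RingHom.id_apply]
    rw [← MemLp.toLp_const_smul]
    refine MemLp.toLp_congr _ _ ((shiftFun_congr z (Lp.coeFn_smul c f)).trans ?_)
    refine Filter.Eventually.of_forall fun t => ?_
    simp only [shiftFun, Pi.smul_apply, smul_eq_mul]
    ring
  norm_map' f := by
    change ‖(memLp_shiftFun z (Lp.memLp f)).toLp (shiftFun z f)‖ = ‖f‖
    rw [Lp.norm_toLp, Lp.norm_def]
    congr 1
    rw [eLpNorm_congr_norm_ae (g := (f : ℝ → ℂ) ∘ fun t => t - z.1)
      (Filter.Eventually.of_forall fun t => norm_shiftFun z f t)]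
    exact eLpNorm_comp_measurePreserving (Lp.aestronglyMeasurable f)
      (measurePreserving_sub_right volume z.1)

/-- `π(z) f (t) = e^{2π i ω t} f(t - x)` for almost every `t`. -/
theorem tfShift_ae (z : ℝ × ℝ) (f : L2) : tfShift z f =ᵐ[volume] shiftFun z f :=
  (memLp_shiftFun z (Lp.memLp f)).coeFn_toLp

/-- The operators `π(k, l)` for the integer lattice. -/
def latticeShift (p : ℤ × ℤ) : L2 →L[ℂ] L2 :=
  (tfShift ((p.1 : ℝ), (p.2 : ℝ))).toContinuousLinearMap

/-- The short-time Fourier transform with Gaussian window,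
`V f (x, ω) = ∫ f(t) e^{-π (t - x)²} e^{-2π i ω t} dt`. -/
def stft (f : ℝ → ℂ) (z : ℝ × ℝ) : ℂ :=
  ∫ t : ℝ, f t * Complex.exp (-Real.pi * ((t : ℂ) - z.1) ^ 2)
    * Complex.exp (-2 * Real.pi * Complex.I * z.2 * t)

/-- Feichtinger's algebra `S₀(ℝ)`: the `f ∈ L²(ℝ)` whose short-time Fourier transform is
integrable over the time-frequency plane. The condition depends on `f` only up to equality
almost everywhere. -/
def MemS0 (f : ℝ → ℂ) : Prop :=
  MemLp f 2 volume ∧ Integrable (stft f) (volume : Measure (ℝ × ℝ))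

/-- The algebra `𝒜₁¹` of the operators `∑ a_{kl} π(k, l)` on `L²(ℝ)` with `a ∈ ℓ¹(ℤ²)`, the series
converging in operator norm. The `π(k, l)` commute, and this is a copy of the Wiener algebra of
absolutely convergent Fourier series on the two-dimensional torus. -/
def wienerAlgebra : Set (L2 →L[ℂ] L2) :=
  {T | ∃ a : ℤ × ℤ → ℂ, Summable (fun p => ‖a p‖) ∧ HasSum (fun p => a p • latticeShift p) T}

/-- `g` is a single generator of the `𝒜₁¹`-module `S₀(ℝ)`. -/
def IsS0Generator (g : L2) : Prop :=
  MemS0 g ∧ ∀ f : L2, MemS0 f → ∃ T ∈ wienerAlgebra, T g = f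

/-- The Gabor system `{π(k, l) g : k, l ∈ ℤ}` is a Riesz basis for `L²(ℝ)`. -/
def IsGaborRieszBasis (g : L2) : Prop :=
  Dense (Submodule.span ℂ (Set.range fun p : ℤ × ℤ => latticeShift p g) : Set L2) ∧
  ∃ A B : ℝ, 0 < A ∧ ∀ c : (ℤ × ℤ) →₀ ℂ,
    A * ∑ p ∈ c.support, ‖c p‖ ^ 2 ≤ ‖∑ p ∈ c.support, c p • latticeShift p g‖ ^ 2 ∧
    ‖∑ p ∈ c.support, c p • latticeShift p g‖ ^ 2 ≤ B * ∑ p ∈ c.support, ‖c p‖ ^ 2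

/-- `S f = u` for the Gabor frame operator `S f = ∑ ⟨f, π(k, l) g⟩ π(k, l) g` of `g`, the series
converging unconditionally in `L²(ℝ)`. (Mathlib's inner product is conjugate-linear in the first
argument.) -/
def FrameOperatorEq (g f u : L2) : Prop :=
  HasSum (fun p : ℤ × ℤ => inner ℂ (latticeShift p g) f • latticeShift p g) u

/-- `h = S⁻¹ g`, that is `S h = g`; `S` is invertible when `g` generates a Gabor Riesz basis. -/
def IsCanonicalDual (g h : L2) : Prop := FrameOperatorEq g h g

/-- `∇₁ f (t) = 2π i t f(t)`. -/
def nabla1 (f : ℝ → ℂ) (t : ℝ) : ℂ := 2 * Real.pi * Complex.I * t * f t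

/-- `u` is the weak (distributional) derivative `∇₂ f = f'` of `f`. -/
def IsNabla2 (f u : ℝ → ℂ) : Prop :=
  LocallyIntegrable f volume ∧ LocallyIntegrable u volume ∧
  ∀ φ : ℝ → ℂ, ContDiff ℝ ∞ φ → HasCompactSupport φ →
    ∫ t : ℝ, f t * deriv φ t = -∫ t : ℝ, u t * φ t

/-- `∇₂ f ∈ S₀(ℝ)`: the distributional derivative of `f` is an element of `S₀(ℝ)`. -/
def Nabla2MemS0 (f : ℝ → ℂ) : Prop := ∃ u : ℝ → ℂ, IsNabla2 f u ∧ MemS0 u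

end BalianLow

end

/-! The argument is Battle's commutator proof of Balian–Low, with finite increments in place of
derivatives. Let T_s, M_s be translation and modulation by s. Suppose ∇₁g and u = h' are in L²;
membership in S₀ includes this. The families v_p = π(p)g and w_p = π(p)h are biorthogonal Bessel
families, so ⟨x, y⟩ = ∑ ⟨x, v_p⟩⟨w_p, y⟩ (`inner_analysis`).

Expand ⟨T_s h − h, M_s g − g⟩ and ⟨M_{−s} h − h, T_{−s} g − g⟩ in this way. By biorthogonality
increments pass between g and h at the cost of a phase (`inner_latticeShift_tfShift_sub`), so after
p ↦ −p the two series differ termwise only by the factor e^{−2πis(k+l)}. Their difference is o(s²):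
T_s h − h is O(s), (M_s g − g)/s converges in L², and the multipliers 1 − e^{−2πis(k+l)} tend
strongly to 0 on ℓ². Yet the commutation relation (`inner_sub_inner_eq`) makes it (1 −
e^{−2πis²})⟨T_s h, M_s g⟩, asymptotic to 2πi s²⟨h, g⟩ = 2πi s², a contradiction. -/

noncomputable section

namespace BalianLow

open Filter Topology

open scoped ComplexConjugate

/-! ### Riesz bounds, biorthogonality and Parseval's identity -/

section Hilbert

variable {ι E : Type*} [NormedAddCommGroup E] [InnerProductSpace ℂ E]

/-- A family is a Bessel family if its coefficient map is bounded into `ℓ²`. -/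
def IsBessel (v : ι → E) : Prop :=
  ∃ C : ℝ, 0 ≤ C ∧ ∀ (f : E) (F : Finset ι), ∑ p ∈ F, ‖inner ℂ (v p) f‖ ^ 2 ≤ C * ‖f‖ ^ 2

/-- The upper Riesz bound on finitely supported coefficients, for functions on finite sets. -/
theorem norm_sum_smul_sq_le_of_finsupp {v : ι → E} {B : ℝ}
    (hB : ∀ c : ι →₀ ℂ, ‖∑ p ∈ c.support, c p • v p‖ ^ 2 ≤ B * ∑ p ∈ c.support, ‖c p‖ ^ 2)
    (F : Finset ι) (c : ι → ℂ) :
    ‖∑ p ∈ F, c p • v p‖ ^ 2 ≤ B * ∑ p ∈ F, ‖c p‖ ^ 2 := by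
  have h := hB (Finsupp.indicator F fun p _ => c p)
  have h1 := Finsupp.sum_indicator_index (s := F) c (h := fun p a => a • v p) (by simp)
  have h2 := Finsupp.sum_indicator_index (s := F) c (h := fun _ a => ‖a‖ ^ 2) (by simp)
  rw [Finsupp.sum] at h1 h2
  rwa [h1, h2] at h

/-- The lower Riesz bound on finitely supported coefficients, for functions on finite sets. -/
theorem sum_sq_le_norm_sum_smul_sq_of_finsupp {v : ι → E} {A : ℝ}
    (hA : ∀ c : ι →₀ ℂ, A * ∑ p ∈ c.support, ‖c p‖ ^ 2 ≤ ‖∑ p ∈ c.support, c p • v p‖ ^ 2)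
    (F : Finset ι) (c : ι → ℂ) :
    A * ∑ p ∈ F, ‖c p‖ ^ 2 ≤ ‖∑ p ∈ F, c p • v p‖ ^ 2 := by
  have h := hA (Finsupp.indicator F fun p _ => c p)
  have h1 := Finsupp.sum_indicator_index (s := F) c (h := fun p a => a • v p) (by simp)
  have h2 := Finsupp.sum_indicator_index (s := F) c (h := fun _ a => ‖a‖ ^ 2) (by simp)
  rw [Finsupp.sum] at h1 h2
  rwa [h1, h2] at h

/-- Duality: synthesize y from the coefficients of f itself. Then ⟨y, f⟩ is the sum σ to be bounded,
and Cauchy–Schwarz with the upper bound gives σ² ≤ |B| σ ‖f‖². -/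
theorem isBessel_of_norm_sum_smul_sq_le {v : ι → E} {B : ℝ}
    (hB : ∀ (F : Finset ι) (c : ι → ℂ), ‖∑ p ∈ F, c p • v p‖ ^ 2 ≤ B * ∑ p ∈ F, ‖c p‖ ^ 2) :
    IsBessel v := by
  refine ⟨|B|, abs_nonneg B, fun f F => ?_⟩
  set σ : ℝ := ∑ p ∈ F, ‖inner ℂ (v p) f‖ ^ 2 with hσ
  have hσ0 : 0 ≤ σ := Finset.sum_nonneg fun p _ => by positivity
  set y : E := ∑ p ∈ F, inner ℂ (v p) f • v p with hy
  have hy2 : ‖y‖ ^ 2 ≤ |B| * σ :=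
    (hB F _).trans (mul_le_mul_of_nonneg_right (le_abs_self B) hσ0)
  have hin : inner ℂ y f = (σ : ℂ) := by
    rw [hy, sum_inner, hσ, Complex.ofReal_sum]
    refine Finset.sum_congr rfl fun p _ => ?_
    rw [inner_smul_left, ← Complex.normSq_eq_conj_mul_self, Complex.normSq_eq_norm_sq]
  have h1 : σ ≤ ‖y‖ * ‖f‖ := by
    have := norm_inner_le_norm (𝕜 := ℂ) y f
    rwa [hin, Complex.norm_real, Real.norm_of_nonneg hσ0] at this
  rcases hσ0.eq_or_lt with h0 | h0
  · rw [← h0]; positivity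
  · have h2 : σ * σ ≤ (|B| * ‖f‖ ^ 2) * σ := by
      calc σ * σ ≤ (‖y‖ * ‖f‖) * (‖y‖ * ‖f‖) := mul_self_le_mul_self hσ0 h1
        _ = ‖y‖ ^ 2 * ‖f‖ ^ 2 := by ring
        _ ≤ (|B| * σ) * ‖f‖ ^ 2 := by gcongr
        _ = _ := by ring
    exact le_of_mul_le_mul_right h2 h0

/-- If `∑ c_p v_p = v_q` in a family with a lower Riesz bound, then `c` is the unit vector at `q`. -/
theorem coeff_eq_of_hasSum [DecidableEq ι] {v : ι → E} {A : ℝ} (hA0 : 0 < A)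
    (hA : ∀ (F : Finset ι) (c : ι → ℂ), A * ∑ p ∈ F, ‖c p‖ ^ 2 ≤ ‖∑ p ∈ F, c p • v p‖ ^ 2)
    {c : ι → ℂ} {q : ι} (hc : HasSum (fun p => c p • v p) (v q)) (p : ι) :
    c p = if p = q then 1 else 0 := by
  have hc' : HasSum (fun p => (c p - if p = q then 1 else 0) • v p) 0 := by
    have h1 : HasSum (fun p => (if p = q then (1 : ℂ) else 0) • v p) (v q) := by
      have := hasSum_ite_eq q (v q)
      refine this.congr_fun fun x => ?_
      by_cases h : x = q <;> simp [h]
    simpa [sub_smul] using hc.sub h1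
  have hlim : Tendsto (fun F : Finset ι =>
      ‖∑ p ∈ F, (c p - if p = q then 1 else 0) • v p‖ ^ 2) atTop (𝓝 0) := by
    have : Tendsto _ atTop _ := hc'.norm.pow 2
    simpa using this
  -- Once F contains p, the lower bound dominates this single coefficient by partial sums tending to
  -- 0.
  have hle : A * ‖c p - if p = q then 1 else 0‖ ^ 2 ≤ 0 := by
    refine ge_of_tendsto hlim ?_
    filter_upwards [eventually_ge_atTop {p}] with F hF
    refine le_trans (mul_le_mul_of_nonneg_left ?_ hA0.le) (hA F _)
    exact Finset.single_le_sum (f := fun p => ‖c p - if p = q then 1 else 0‖ ^ 2)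
      (fun _ _ => by positivity) (hF (Finset.mem_singleton_self p))
  have h0 : ‖c p - if p = q then 1 else 0‖ ^ 2 ≤ 0 := by
    by_contra h
    exact absurd hle (not_le.mpr (mul_pos hA0 (not_le.mp h)))
  have h00 : ‖c p - if p = q then 1 else 0‖ = 0 := by
    have := sq_nonneg ‖c p - if p = q then 1 else 0‖
    exact pow_eq_zero_iff two_ne_zero |>.mp (le_antisymm h0 this)
  exact sub_eq_zero.mp (norm_eq_zero.mp h00)

/-- A family biorthogonal to a complete family with a lower Riesz bound is a Bessel family. -/
theorem isBessel_of_biorthogonal [DecidableEq ι] {v w : ι → E} {A : ℝ} (hA0 : 0 < A)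
    (hA : ∀ (F : Finset ι) (c : ι → ℂ), A * ∑ p ∈ F, ‖c p‖ ^ 2 ≤ ‖∑ p ∈ F, c p • v p‖ ^ 2)
    (hd : Dense (Submodule.span ℂ (Set.range v) : Set E))
    (hvw : ∀ p q, inner ℂ (w p) (v q) = if p = q then 1 else 0) :
    IsBessel w := by
  refine ⟨A⁻¹, by positivity, fun f F => ?_⟩
  -- On the span of v the functionals ⟨w_p, ·⟩ read off coefficients, so the lower Riesz bound is
  -- the Bessel inequality with constant 1/A; density does the rest.
  refine hd.induction (P := fun f => ∑ p ∈ F, ‖inner ℂ (w p) f‖ ^ 2 ≤ A⁻¹ * ‖f‖ ^ 2) ?_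
    (isClosed_le (by fun_prop) (by fun_prop)) f
  intro x hx
  obtain ⟨c, rfl⟩ := (Finsupp.mem_span_range_iff_exists_finsupp).mp hx
  have hcoef : ∀ p, inner ℂ (w p) (c.sum fun i a => a • v i) = c p := by
    intro p
    rw [Finsupp.sum, inner_sum]
    simp only [inner_smul_right, hvw, mul_ite, mul_one, mul_zero, Finset.sum_ite_eq]
    by_cases h : p ∈ c.support
    · simp [h]
    · rw [if_neg h, Finsupp.notMem_support_iff.mp h]
  simp only [hcoef]
  rw [le_inv_mul_iff₀ hA0]
  have h1 := hA (c.support ∪ F) c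
  rw [← Finset.sum_subset (f := fun p => c p • v p) Finset.subset_union_left (fun x _ hx => by
      rw [Finsupp.notMem_support_iff.mp hx, zero_smul])] at h1
  refine le_trans (mul_le_mul_of_nonneg_left ?_ hA0.le) h1
  exact Finset.sum_le_sum_of_subset_of_nonneg Finset.subset_union_right fun _ _ _ => by positivity

/-- The analysis operator `f ↦ (⟨v_p, f⟩)_p` of a Bessel family. -/
def analysis (v : ι → E) (hv : IsBessel v) : E →L[ℂ] lp (fun _ : ι => ℂ) 2 :=
  LinearMap.mkContinuousOfExistsBound
    { toFun := fun f => ⟨fun p => inner ℂ (v p) f, by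
        obtain ⟨C, _, hC⟩ := hv
        refine memℓp_gen' (C := C * ‖f‖ ^ 2) fun F => ?_
        simpa using hC f F⟩
      map_add' := fun f g => by
        ext p; exact inner_add_right _ _ _
      map_smul' := fun a f => by
        ext p; exact inner_smul_right _ _ _ }
    (by
      obtain ⟨C, hC0, hC⟩ := hv
      refine ⟨√C, fun f => ?_⟩
      refine lp.norm_le_of_forall_sum_le (by simp) (by positivity) fun F => ?_
      have h := hC f F
      have e : (√C * ‖f‖) ^ (2 : ℝ≥0∞).toReal = C * ‖f‖ ^ 2 := by
        simp [mul_pow, Real.sq_sqrt hC0]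
      rw [e]
      simpa using h)

theorem analysis_apply {v : ι → E} (hv : IsBessel v) (f : E) (p : ι) :
    analysis v hv f p = inner ℂ (v p) f := rfl

/-- Parseval's identity for a biorthogonal pair of Bessel families. -/
theorem inner_analysis [DecidableEq ι] {v w : ι → E} (hv : IsBessel v) (hw : IsBessel w)
    (hd : Dense (Submodule.span ℂ (Set.range v) : Set E))
    (hvw : ∀ p q, inner ℂ (w p) (v q) = if p = q then 1 else 0) (x y : E) :
    inner ℂ (analysis v hv x) (analysis w hw y) = inner ℂ x y := by
  -- Both sides are continuous and linear in y, so y = v_q suffices; its coefficients against w form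
  -- a unit vector.
  have h : (innerSL ℂ (analysis v hv x)).comp (analysis w hw) = innerSL ℂ x := by
    refine ContinuousLinearMap.ext_on hd ?_
    rintro _ ⟨q, rfl⟩
    have hq : analysis w hw (v q) = lp.single 2 q 1 := by
      ext p
      rw [analysis_apply, hvw, lp.single_apply]
      by_cases h : p = q
      · subst h; simp
      · simp [h]
    simp only [ContinuousLinearMap.comp_apply, innerSL_apply_apply, hq]
    rw [lp.inner_single_right, analysis_apply]
    simp
  exact congrArg (fun T : E →L[ℂ] ℂ => T y) h

end Hilbert

/-! ### Strong convergence of bounded multipliers on ℓ² -/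

section Multiplier

variable {ι : Type*}

/-- The pointwise product of a sequence bounded by `2` with an element of `ℓ²`. -/
def boundedMul (χ : ι → ℂ) (hχ : ∀ p, ‖χ p‖ ≤ 2) (c : lp (fun _ : ι => ℂ) 2) :
    lp (fun _ : ι => ℂ) 2 :=
  ⟨fun p => χ p * c p, (lp.memℓp ((2 : ℂ) • c)).mono' fun p => by
    simpa using mul_le_mul_of_nonneg_right (hχ p) (norm_nonneg (c p))⟩

theorem boundedMul_apply (χ : ι → ℂ) (hχ : ∀ p, ‖χ p‖ ≤ 2) (c : lp (fun _ : ι => ℂ) 2) (p : ι) :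
    boundedMul χ hχ c p = χ p * c p := rfl

theorem norm_boundedMul_le (χ : ι → ℂ) (hχ : ∀ p, ‖χ p‖ ≤ 2) (c : lp (fun _ : ι => ℂ) 2) :
    ‖boundedMul χ hχ c‖ ≤ 2 * ‖c‖ := by
  have h : ‖boundedMul χ hχ c‖ ≤ ‖(2 : ℂ) • c‖ := by
    refine lp.norm_mono (by simp) fun p => ?_
    simpa [boundedMul_apply] using mul_le_mul_of_nonneg_right (hχ p) (norm_nonneg (c p))
  simpa [norm_smul] using h

theorem boundedMul_sub (χ : ι → ℂ) (hχ : ∀ p, ‖χ p‖ ≤ 2) (c d : lp (fun _ : ι => ℂ) 2) :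
    boundedMul χ hχ (c - d) = boundedMul χ hχ c - boundedMul χ hχ d := by
  ext p
  simp [boundedMul_apply, mul_sub]

/-- Multiplication by bounded sequences tending to zero pointwise tends to zero strongly. -/
theorem tendsto_norm_boundedMul {κ : Type*} {l : Filter κ} {χ : κ → ι → ℂ}
    (hχ : ∀ s p, ‖χ s p‖ ≤ 2) (hlim : ∀ p, Tendsto (fun s => χ s p) l (𝓝 0))
    {c : κ → lp (fun _ : ι => ℂ) 2} {d : lp (fun _ : ι => ℂ) 2} (hc : Tendsto c l (𝓝 d)) :
    Tendsto (fun s => ‖boundedMul (χ s) (hχ s) (c s)‖) l (𝓝 0) := by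
  have hd : Tendsto (fun s => ‖boundedMul (χ s) (hχ s) d‖) l (𝓝 0) := by
    have hsum : Summable fun p => 4 * ‖d p‖ ^ 2 := by
      have := (lp.memℓp d).summable (by simp)
      simpa using this.mul_left 4
    have h2 : Tendsto (fun s => ∑' p, ‖χ s p * d p‖ ^ 2) l (𝓝 (∑' _ : ι, (0 : ℝ))) := by
      refine tendsto_tsum_of_dominated_convergence hsum (fun p => ?_)
        (Eventually.of_forall fun s p => ?_)
      · have := (((hlim p).mul_const (d p)).norm.pow 2)
        simpa using this
      · rw [norm_pow, norm_norm, norm_mul, mul_pow]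
        have h := pow_le_pow_left₀ (norm_nonneg _) (hχ s p) 2
        nlinarith [sq_nonneg ‖d p‖]
    have h3 : ∀ s, ‖boundedMul (χ s) (hχ s) d‖ = √(∑' p, ‖χ s p * d p‖ ^ 2) := by
      intro s
      have := lp.norm_rpow_eq_tsum (p := 2) (by simp) (boundedMul (χ s) (hχ s) d)
      simp only [ENNReal.toReal_ofNat, Real.rpow_ofNat, boundedMul_apply] at this
      rw [← this, Real.sqrt_sq (norm_nonneg _)]
    simp only [h3]
    simpa using h2.sqrt
  -- Split c s = (c s − d) + d: the first part is controlled by the uniform bound 2, the second by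
  -- dominated convergence.
  have hcd : Tendsto (fun s => 2 * ‖c s - d‖ + ‖boundedMul (χ s) (hχ s) d‖) l (𝓝 0) := by
    have := ((tendsto_iff_norm_sub_tendsto_zero.mp hc).const_mul 2).add hd
    simpa using this
  refine squeeze_zero (fun s => norm_nonneg _) (fun s => ?_) hcd
  calc ‖boundedMul (χ s) (hχ s) (c s)‖
      = ‖boundedMul (χ s) (hχ s) (c s - d) + boundedMul (χ s) (hχ s) d‖ := by
        rw [boundedMul_sub, sub_add_cancel]
    _ ≤ _ := (norm_add_le _ _).trans (add_le_add_left (norm_boundedMul_le _ _ _) _)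

end Multiplier

/-! ### Commutation relations of time-frequency shifts -/

section TimeFrequency

/-- The character `x ↦ e^{2π i x}`. -/
def expChar (x : ℝ) : ℂ := Complex.exp (2 * Real.pi * Complex.I * x)

theorem expChar_add (x y : ℝ) : expChar (x + y) = expChar x * expChar y := by
  rw [expChar, expChar, expChar, ← Complex.exp_add]
  push_cast
  ring_nf

theorem expChar_zero : expChar 0 = 1 := by simp [expChar]

theorem expChar_eq (x : ℝ) : expChar x = Complex.exp (Complex.I * ((2 * Real.pi * x : ℝ) : ℂ)) := by
  rw [expChar]
  push_cast
  ring_nf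

theorem norm_expChar (x : ℝ) : ‖expChar x‖ = 1 := by
  rw [expChar_eq, Complex.norm_exp_I_mul_ofReal]

theorem conj_expChar (x : ℝ) : conj (expChar x) = expChar (-x) := by
  rw [expChar, expChar, ← Complex.exp_conj]
  simp [Complex.conj_ofNat]

theorem expChar_intCast (n : ℤ) : expChar n = 1 := by
  rw [expChar, Complex.exp_eq_one_iff]
  exact ⟨n, by push_cast; ring⟩

theorem norm_expChar_sub_one_le (x : ℝ) : ‖expChar x - 1‖ ≤ 2 * Real.pi * |x| := by
  rw [expChar_eq]
  refine Real.norm_exp_I_mul_ofReal_sub_one_le.trans_eq ?_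
  rw [Real.norm_eq_abs, abs_mul, abs_of_pos (by positivity : (0 : ℝ) < 2 * Real.pi)]

theorem hasDerivAt_expChar_zero : HasDerivAt expChar (2 * Real.pi * Complex.I) 0 := by
  have h : HasDerivAt (fun x : ℝ => Complex.exp (2 * Real.pi * Complex.I * (x : ℂ)))
      (Complex.exp (2 * Real.pi * Complex.I * ((0 : ℝ) : ℂ)) * (2 * Real.pi * Complex.I * 1)) 0 :=
    ((Complex.ofRealCLM.hasDerivAt (x := (0 : ℝ))).const_mul _).cexp
  exact h.congr_deriv (by simp)

@[fun_prop]
theorem continuous_expChar : Continuous expChar := by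
  unfold expChar
  fun_prop

theorem shiftFun_eq (z : ℝ × ℝ) (f : ℝ → ℂ) (t : ℝ) :
    shiftFun z f t = expChar (z.2 * t) * f (t - z.1) := by
  rw [shiftFun, expChar]
  push_cast
  ring_nf

theorem tfShift_tfShift (z w : ℝ × ℝ) (f : L2) :
    tfShift z (tfShift w f) = expChar (-(z.1 * w.2)) • tfShift (z + w) f := by
  apply Lp.ext
  filter_upwards [tfShift_ae z (tfShift w f), shiftFun_congr z (tfShift_ae w f),
    Lp.coeFn_smul (expChar (-(z.1 * w.2))) (tfShift (z + w) f), tfShift_ae (z + w) f]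
    with t h1 h2 h3 h4
  rw [h1, h2, h3, Pi.smul_apply, h4, shiftFun_eq, shiftFun_eq, shiftFun_eq, smul_eq_mul,
    ← mul_assoc, ← mul_assoc, ← expChar_add, ← expChar_add, Prod.snd_add, Prod.fst_add,
    sub_add_eq_sub_sub]
  ring_nf

theorem tfShift_zero (f : L2) : tfShift 0 f = f := by
  apply Lp.ext
  filter_upwards [tfShift_ae 0 f] with t h
  rw [h, shiftFun_eq]
  simp [expChar_zero]

/-- Pure translations and pure modulations are inverted by negating the parameter. -/
theorem tfShift_neg_tfShift {z : ℝ × ℝ} (hz : z.1 * z.2 = 0) (f : L2) :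
    tfShift (-z) (tfShift z f) = f := by
  rw [tfShift_tfShift, neg_add_cancel, tfShift_zero, Prod.fst_neg, neg_mul, hz]
  simp [expChar_zero]

theorem inner_tfShift_right {z : ℝ × ℝ} (hz : z.1 * z.2 = 0) (f g : L2) :
    inner ℂ f (tfShift z g) = inner ℂ (tfShift (-z) f) g := by
  rw [← (tfShift (-z)).inner_map_map f (tfShift z g), tfShift_neg_tfShift hz]

theorem tfShift_comm (z w : ℝ × ℝ) (f : L2) :
    tfShift z (tfShift w f) = expChar (w.1 * z.2 - z.1 * w.2) • tfShift w (tfShift z f) := by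
  rw [tfShift_tfShift, tfShift_tfShift, smul_smul, ← expChar_add, add_comm w z]
  ring_nf

theorem latticeShift_eq (p : ℤ × ℤ) (f : L2) :
    latticeShift p f = tfShift ((p.1 : ℝ), (p.2 : ℝ)) f := rfl

/-- The phase of `tfShift_tfShift` is trivial because the product of two integers is an integer. -/
theorem latticeShift_latticeShift (p q : ℤ × ℤ) (f : L2) :
    latticeShift p (latticeShift q f) = latticeShift (p + q) f := by
  rw [latticeShift_eq, latticeShift_eq, latticeShift_eq, tfShift_tfShift]
  have h : expChar (-((p.1 : ℝ) * q.2)) = 1 := by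
    have := expChar_intCast (-(p.1 * q.2))
    push_cast at this
    exact this
  rw [h, one_smul]
  congr 2
  ext <;> simp

theorem inner_latticeShift_left (p : ℤ × ℤ) (f g : L2) :
    inner ℂ (latticeShift p f) g = inner ℂ f (latticeShift (-p) g) := by
  have h : latticeShift p (latticeShift (-p) g) = g := by
    rw [latticeShift_latticeShift, add_neg_cancel, latticeShift_eq]
    simpa [← Prod.zero_eq_mk] using tfShift_zero g
  conv_lhs => rw [← h]
  exact (tfShift ((p.1 : ℝ), (p.2 : ℝ))).inner_map_map _ _

/-- Moving a pure translation or modulation increment from one side of a biorthogonal pair to the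
other costs only a phase. -/
theorem inner_latticeShift_tfShift_sub {g h : L2}
    (hgh : ∀ p : ℤ × ℤ, inner ℂ (latticeShift p h) g = if p = 0 then (1 : ℂ) else 0)
    {z : ℝ × ℝ} (hz : z.1 * z.2 = 0) (p : ℤ × ℤ) :
    inner ℂ (latticeShift p h) (tfShift z g - g) =
      expChar (p.1 * z.2 - z.1 * p.2) *
        inner ℂ (tfShift (-z) h - h) (latticeShift (-p) g) := by
  have h1 : inner ℂ (latticeShift p h) (tfShift z g) =
      expChar (p.1 * z.2 - z.1 * p.2) *
        inner ℂ (tfShift (-z) h) (latticeShift (-p) g) := by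
    rw [inner_tfShift_right hz, latticeShift_eq, tfShift_comm, ← latticeShift_eq, inner_smul_left,
      inner_latticeShift_left, conj_expChar]
    congr 2
    simp only [Prod.fst_neg, Prod.snd_neg]
    ring
  rw [inner_sub_right, inner_sub_left, h1, ← inner_latticeShift_left, ← inner_latticeShift_left,
    hgh, mul_sub]
  -- The leftover term ⟨π(p)h, g⟩ survives only at p = 0, where the phase is 1.
  by_cases hp : p = 0
  · subst hp
    simp [expChar_zero]
  · simp [hp]

/-- The canonical commutation relation for finite increments. -/
theorem inner_sub_inner_eq (g h : L2) (s : ℝ) :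
    inner ℂ (tfShift (s, 0) h - h) (tfShift (0, s) g - g)
      - inner ℂ (tfShift (0, -s) h - h) (tfShift (-s, 0) g - g)
      = (1 - expChar (-(s * s))) * inner ℂ (tfShift (s, 0) h) (tfShift (0, s) g) := by
  have e1 : inner ℂ h (tfShift (0, s) g) = inner ℂ (tfShift (0, -s) h) g := by
    simpa using inner_tfShift_right (z := (0, s)) (by simp) h g
  have e2 : inner ℂ h (tfShift (-s, 0) g) = inner ℂ (tfShift (s, 0) h) g := by
    simpa using inner_tfShift_right (z := (-s, 0)) (by simp) h g
  have e3 : inner ℂ (tfShift (0, -s) h) (tfShift (-s, 0) g)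
      = expChar (-(s * s)) * inner ℂ (tfShift (s, 0) h) (tfShift (0, s) g) := by
    have a : inner ℂ (tfShift (0, -s) h) (tfShift (-s, 0) g)
        = inner ℂ h (tfShift (0, s) (tfShift (-s, 0) g)) := by
      simpa using (inner_tfShift_right (z := (0, s)) (by simp) h (tfShift (-s, 0) g)).symm
    have b : inner ℂ (tfShift (s, 0) h) (tfShift (0, s) g)
        = inner ℂ h (tfShift (-s, 0) (tfShift (0, s) g)) := by
      simpa using (inner_tfShift_right (z := (-s, 0)) (by simp) h (tfShift (0, s) g)).symm
    rw [a, b, tfShift_comm (0, s), inner_smul_right]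
    congr 2
    simp
  -- The mixed terms cancel by `e1` and `e2`; only the two double shifts remain, and `e3` compares
  -- them.
  rw [inner_sub_left, inner_sub_right, inner_sub_right, inner_sub_left, inner_sub_right,
    inner_sub_right, e1, e2, e3]
  ring

end TimeFrequency

/-! ### Difference quotients in L² -/

section Increments

/-- If `t f(t)` is square-integrable then modulations of `f` are differentiable in `L²`. -/
theorem tendsto_modulation_sub {f : L2} (hf : MemLp (nabla1 f) 2 volume) :
    Tendsto (fun s : ℝ => (s : ℂ)⁻¹ • (tfShift (0, s) f - f)) (𝓝[>] 0)
      (𝓝 (hf.toLp (nabla1 f))) := by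
  apply Lp.tendsto_Lp_of_tendsto_eLpNorm
  have hae : ∀ s : ℝ, eLpNorm (⇑((s : ℂ)⁻¹ • (tfShift (0, s) f - f)) - nabla1 f) 2 volume
      = (∫⁻ t, ‖(s : ℂ)⁻¹ * (expChar (s * t) * f t - f t) - nabla1 f t‖ₑ ^ (2 : ℝ))
        ^ (1 / 2 : ℝ) := by
    intro s
    rw [eLpNorm_eq_lintegral_rpow_enorm_toReal (by simp) (by simp)]
    simp only [ENNReal.toReal_ofNat]
    congr 1
    refine lintegral_congr_ae ?_
    filter_upwards [Lp.coeFn_smul (s : ℂ)⁻¹ (tfShift (0, s) f - f), Lp.coeFn_sub (tfShift (0, s) f) f,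
      tfShift_ae (0, s) f] with t h1 h2 h3
    rw [Pi.sub_apply, h1, Pi.smul_apply, h2, Pi.sub_apply, h3, shiftFun_eq, smul_eq_mul]
    simp
  simp only [hae]
  have hlim : Tendsto (fun s : ℝ =>
      ∫⁻ t, ‖(s : ℂ)⁻¹ * (expChar (s * t) * f t - f t) - nabla1 f t‖ₑ ^ (2 : ℝ)) (𝓝[>] 0)
      (𝓝 (∫⁻ _ : ℝ, 0)) := by
    -- From |e^{2πist} − 1| ≤ 2π|st| the difference quotient is at most |∇₁f|, which gives the
    -- majorant (2|∇₁f|)².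
    refine tendsto_lintegral_filter_of_dominated_convergence'
      (fun t => (2 * ‖nabla1 f t‖ₑ) ^ (2 : ℝ)) ?_ ?_ ?_ ?_
    · refine Eventually.of_forall fun s => ?_
      have hfm := (Lp.aestronglyMeasurable f).aemeasurable
      have he : AEMeasurable (fun t : ℝ => expChar (s * t)) volume :=
        (by fun_prop : Continuous fun t : ℝ => expChar (s * t)).aemeasurable
      exact ((((he.mul hfm).sub hfm).const_mul _).sub
        hf.aestronglyMeasurable.aemeasurable).enorm.pow_const _
    · filter_upwards [self_mem_nhdsWithin] with s hs
      refine Eventually.of_forall fun t => ?_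
      refine ENNReal.rpow_le_rpow ?_ (by norm_num)
      rw [two_mul]
      refine enorm_sub_le.trans (add_le_add_left ?_ _)
      rw [enorm_le_iff_norm_le]
      have hs0 : (0 : ℝ) < s := hs
      have h1 := norm_expChar_sub_one_le (s * t)
      calc ‖(s : ℂ)⁻¹ * (expChar (s * t) * f t - f t)‖
          = s⁻¹ * (‖expChar (s * t) - 1‖ * ‖f t‖) := by
            rw [← norm_mul, norm_mul, norm_inv, Complex.norm_real, Real.norm_of_nonneg hs0.le,
              sub_one_mul]
        _ ≤ s⁻¹ * ((2 * Real.pi * |s * t|) * ‖f t‖) := by gcongr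
        _ = 2 * Real.pi * |t| * ‖f t‖ := by
            rw [abs_mul, abs_of_pos hs0]; field_simp
        _ = ‖nabla1 f t‖ := by
            simp [nabla1, abs_of_pos Real.pi_pos]
    · have h2 := (hf.const_mul 2).eLpNorm_lt_top
      have := lintegral_rpow_enorm_lt_top_of_eLpNorm_lt_top (p := 2) (by simp) (by simp) h2
      refine ne_of_lt (lt_of_le_of_lt (le_of_eq ?_) this)
      refine lintegral_congr fun t => ?_
      have h : ‖(2 : ℂ)‖ₑ = 2 := by rw [← ofReal_norm]; norm_num
      rw [enorm_mul, h, ENNReal.toReal_ofNat]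
    · refine Eventually.of_forall fun t => ?_
      have hd : Tendsto (fun s : ℝ => (s : ℂ)⁻¹ * (expChar (s * t) - 1)) (𝓝[>] 0)
          (𝓝 (2 * Real.pi * Complex.I * t)) := by
        have h0 : HasDerivAt (fun s : ℝ => expChar (s * t)) (t • (2 * Real.pi * Complex.I)) 0 := by
          have := hasDerivAt_expChar_zero
          rw [← zero_mul t] at this
          exact HasDerivAt.scomp (0 : ℝ) this (hasDerivAt_mul_const t)
        have h1 := h0.tendsto_slope_zero_right
        simp only [zero_add, zero_mul, expChar_zero] at h1
        refine (h1.congr fun s => ?_).trans (le_of_eq ?_)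
        · simp [Complex.real_smul]
        · rw [Complex.real_smul, mul_comm]
      have h2 : Tendsto (fun s : ℝ => (s : ℂ)⁻¹ * (expChar (s * t) * f t - f t) - nabla1 f t)
          (𝓝[>] 0) (𝓝 0) := by
        have := (hd.mul_const (f t)).sub_const (nabla1 f t)
        rw [nabla1, sub_self] at this
        refine this.congr fun s => ?_
        rw [nabla1]; ring
      have h3 := (ENNReal.continuous_rpow_const (y := 2)).tendsto _ |>.comp h2.enorm
      simpa [Function.comp_def] using h3
  have := (ENNReal.continuous_rpow_const (y := (1 / 2 : ℝ))).tendsto _ |>.comp hlim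
  simpa [Function.comp_def] using this

/-- Translates of a smooth compactly supported function pair differentiably with a function having
a weak derivative. -/
theorem hasDerivAt_inner_translate {f u φ : L2} {ψ : ℝ → ℂ} (hfu : IsNabla2 f u)
    (hφ : φ =ᵐ[volume] ψ) (hψ : ContDiff ℝ ∞ ψ) (hc : HasCompactSupport ψ) (x : ℝ) :
    HasDerivAt (fun x : ℝ => inner ℂ (tfShift (x, 0) φ) f) (inner ℂ (tfShift (x, 0) φ) u) x := by
  have hin : ∀ (v : L2) (x : ℝ),
      inner ℂ (tfShift (x, 0) φ) v = ∫ t, v t * conj (ψ (t - x)) := by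
    intro v x
    rw [L2.inner_def]
    refine integral_congr_ae ?_
    filter_upwards [tfShift_ae (x, 0) φ, shiftFun_congr (x, 0) hφ] with t h1 h2
    rw [h1, h2, shiftFun_eq]
    simp [expChar_zero]
  have hconj : ContDiff ℝ ∞ fun y : ℝ => conj (ψ y) := Complex.conjCLE.contDiff.comp hψ
  have hg : ContDiff ℝ ∞ fun y : ℝ => conj (ψ (-y)) := hconj.comp contDiff_neg
  have hcc : HasCompactSupport fun y : ℝ => conj (ψ y) :=
    hc.comp_left (g := fun z : ℂ => conj z) (by simp)
  have hgc : HasCompactSupport fun y : ℝ => conj (ψ (-y)) :=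
    hcc.comp_homeomorph (Homeomorph.neg ℝ)
  have h := hgc.hasDerivAt_convolution_right (ContinuousLinearMap.mul ℝ ℂ) hfu.1 (hg.of_le (by simp)) x
  -- Writing the pairing as a convolution puts the derivative on the test function; the weak
  -- derivative then moves it to f. The signs from reflection and from integration by parts cancel.
  have e1 : (fun x : ℝ => inner ℂ (tfShift (x, 0) φ) f) =
      convolution f (fun y : ℝ => conj (ψ (-y))) (ContinuousLinearMap.mul ℝ ℂ) volume := by
    funext x
    rw [hin]
    simp [convolution]
  rw [e1]
  refine h.congr_deriv ?_
  rw [hin, convolution]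
  have hD : ∀ y : ℝ, deriv (fun y : ℝ => conj (ψ (-y))) y
      = -deriv (fun y : ℝ => conj (ψ y)) (-y) := fun y =>
    deriv_comp_neg (fun y : ℝ => conj (ψ y)) y
  have hT : ContDiff ℝ ∞ fun t : ℝ => conj (ψ (t - x)) :=
    hconj.comp (contDiff_id.sub contDiff_const)
  have hTc : HasCompactSupport fun t : ℝ => conj (ψ (t - x)) :=
    hcc.comp_homeomorph (Homeomorph.subRight x)
  have hw := hfu.2.2 _ hT hTc
  have hDT : ∀ t : ℝ, deriv (fun t : ℝ => conj (ψ (t - x))) t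
      = deriv (fun y : ℝ => conj (ψ y)) (t - x) := fun t =>
    deriv_comp_sub_const (fun y : ℝ => conj (ψ y)) x t
  simp only [hDT] at hw
  simp only [ContinuousLinearMap.mul_apply', hD, neg_sub, mul_neg, integral_neg, hw, neg_neg]

/-- The `L²` modulus of continuity of a function with a weak derivative in `L²`. -/
theorem norm_translate_sub_le {f u : L2} (hfu : IsNabla2 f u) (r : ℝ) :
    ‖tfShift (r, 0) f - f‖ ≤ |r| * ‖u‖ := by
  have key : ∀ φ : L2, ‖inner ℂ φ (tfShift (r, 0) f - f)‖ ≤ |r| * ‖u‖ * ‖φ‖ := by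
    intro φ
    have hd := Lp.dense_hasCompactSupport_contDiff (E := ℝ) (F := ℂ) (μ := volume) (p := 2)
      (by simp)
    refine hd.induction
      (P := fun φ => ‖inner ℂ φ (tfShift (r, 0) f - f)‖ ≤ |r| * ‖u‖ * ‖φ‖) ?_
      (isClosed_le (by fun_prop) (by fun_prop)) φ
    rintro φ ⟨ψ, hφ, hc, hψ⟩
    -- Mean value inequality for x ↦ ⟨T_x φ, f⟩ between 0 and −r, since T_r on f is T_{−r} on φ.
    have h := convex_univ.norm_image_sub_le_of_norm_hasDerivWithin_le (C := ‖φ‖ * ‖u‖)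
      (fun x _ => (hasDerivAt_inner_translate hfu hφ hψ hc x).hasDerivWithinAt)
      (fun x _ => (norm_inner_le_norm _ _).trans_eq (by rw [(tfShift (x, 0)).norm_map]))
      (Set.mem_univ 0) (Set.mem_univ (-r))
    have e : inner ℂ (tfShift (-r, 0) φ) f = inner ℂ φ (tfShift (r, 0) f) := by
      simpa using (inner_tfShift_right (z := (r, 0)) (by simp) φ f).symm
    have e0 : tfShift ((0 : ℝ), (0 : ℝ)) φ = φ := tfShift_zero φ
    rw [e, e0, ← inner_sub_right] at h
    refine h.trans_eq ?_
    simp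
    ring
  set y := tfShift (r, 0) f - f
  have h := key y
  rw [inner_self_eq_norm_sq_to_K] at h
  rcases (norm_nonneg y).eq_or_lt with h0 | h0
  · rw [← h0]; positivity
  · refine le_of_mul_le_mul_right ?_ h0
    simpa [sq] using h

end Increments

/-! ### The Balian–Low contradiction -/

/-- The Balian–Low theorem at the critical lattice `ℤ²` for a Gabor Riesz basis: if `t g(t)` is
square-integrable then the canonical dual atom has no square-integrable weak derivative. Neither
membership in `S₀(ℝ)` nor the generator property is used. -/
theorem IsGaborRieszBasis.not_isNabla2 {g h u : L2} (hriesz : IsGaborRieszBasis g)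
    (hdual : IsCanonicalDual g h) (hg : MemLp (nabla1 g) 2 volume) : ¬ IsNabla2 h u := by
  intro hu
  obtain ⟨hd, A, B, hA0, hAB⟩ := hriesz
  set v : ℤ × ℤ → L2 := fun p => latticeShift p g with hv
  set w : ℤ × ℤ → L2 := fun p => latticeShift p h with hw
  have hA := sum_sq_le_norm_sum_smul_sq_of_finsupp (v := v) fun c => (hAB c).1
  have hB := norm_sum_smul_sq_le_of_finsupp (v := v) fun c => (hAB c).2
  have hgh : ∀ p : ℤ × ℤ, inner ℂ (v p) h = if p = 0 then (1 : ℂ) else 0 := by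
    have h0 : v 0 = g := by
      simpa [hv, latticeShift_eq, ← Prod.zero_eq_mk] using tfShift_zero g
    -- S h = g expands v_0 in the family v with coefficients ⟨v_p, h⟩, so uniqueness of coefficients
    -- yields biorthogonality.
    refine coeff_eq_of_hasSum hA0 hA ?_
    rw [h0]
    exact hdual
  have hhg : ∀ p : ℤ × ℤ, inner ℂ (w p) g = if p = 0 then (1 : ℂ) else 0 := by
    intro p
    rw [hw, inner_latticeShift_left, ← inner_conj_symm]
    change conj (inner ℂ (v (-p)) h) = _
    rw [hgh]
    by_cases hp : p = 0 <;> simp [hp]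
  have hbi : ∀ p q, inner ℂ (w p) (v q) = if p = q then (1 : ℂ) else 0 := by
    intro p q
    have : inner ℂ (w p) (v q) = inner ℂ (w (p - q)) g := by
      simp only [hw, hv]
      rw [inner_latticeShift_left, inner_latticeShift_left, latticeShift_latticeShift]
      congr 3
      ring
    rw [this, hhg]
    simp only [sub_eq_zero]
  have hvB : IsBessel v := isBessel_of_norm_sum_smul_sq_le hB
  have hwB : IsBessel w := isBessel_of_biorthogonal hA0 hA hd hbi
  set χ : ℝ → ℤ × ℤ → ℂ := fun s p => 1 - expChar (-(s * (p.1 + p.2))) with hχ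
  have hχ2 : ∀ s p, ‖χ s p‖ ≤ 2 := fun s p => by
    refine (norm_sub_le _ _).trans ?_
    rw [norm_one, norm_expChar]
    norm_num
  have hχ0 : ∀ p, Tendsto (fun s => χ s p) (𝓝[>] 0) (𝓝 0) := by
    intro p
    have hc : Continuous fun s => χ s p := by fun_prop
    have := (hc.tendsto 0).mono_left (nhdsWithin_le_nhds (s := Set.Ioi 0))
    simpa [hχ, expChar_zero] using this
  set a : ℝ → L2 := fun s => tfShift (0, s) g - g with ha
  set b : ℝ → L2 := fun s => tfShift (s, 0) h - h with hb
  have hparseval : ∀ x y : L2, HasSum (fun p => inner ℂ x (v p) * inner ℂ (w p) y) (inner ℂ x y) := by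
    intro x y
    have := lp.hasSum_inner (𝕜 := ℂ) (analysis v hvB x) (analysis w hwB y)
    rw [inner_analysis hvB hwB hd hbi] at this
    refine this.congr_fun fun p => ?_
    rw [analysis_apply, analysis_apply, RCLike.inner_apply, inner_conj_symm, mul_comm]
  have hR : ∀ s : ℝ, HasSum (fun p : ℤ × ℤ =>
      expChar (-(s * (p.1 + p.2))) * (inner ℂ (b s) (v p) * inner ℂ (w p) (a s)))
      (inner ℂ (tfShift (0, -s) h - h) (tfShift (-s, 0) g - g)) := by
    intro s
    have hs := (hparseval (tfShift (0, -s) h - h) (tfShift (-s, 0) g - g))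
    -- Moving an increment across turns π(p) into π(−p), so this reindexing aligns the two series.
    rw [← (Equiv.neg (ℤ × ℤ)).hasSum_iff] at hs
    refine hs.congr_fun fun p => ?_
    have e1 := inner_latticeShift_tfShift_sub hhg (z := (0, s)) (by simp) p
    have e2 := inner_latticeShift_tfShift_sub hhg (z := (-s, 0)) (by simp) (-p)
    simp only [Prod.neg_mk, neg_zero, neg_neg, mul_zero, zero_mul, sub_zero, zero_sub,
      Prod.fst_neg, Prod.snd_neg, Int.cast_neg] at e1 e2
    simp only [Function.comp_apply, Equiv.neg_apply]
    change _ * (inner ℂ (b s) (latticeShift p g) * inner ℂ (latticeShift p h) (a s))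
      = inner ℂ _ (latticeShift (-p) g) * inner ℂ (latticeShift (-p) h) _
    rw [e2, ha, e1, hb]
    have e3 : expChar (-(s * (p.1 + p.2))) * expChar (p.1 * s) = expChar (-(s * p.2)) := by
      rw [← expChar_add]
      ring_nf
    have e4 : expChar (-(-s * -(p.2 : ℝ))) = expChar (-(s * p.2)) := by ring_nf
    rw [e4, ← e3]
    ring
  have hLR : ∀ s : ℝ, inner ℂ (analysis v hvB (b s))
      (boundedMul (χ s) (hχ2 s) (analysis w hwB (a s)))
      = (1 - expChar (-(s * s))) * inner ℂ (tfShift (s, 0) h) (tfShift (0, s) g) := by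
    intro s
    rw [← inner_sub_inner_eq]
    refine (lp.hasSum_inner _ _).unique (((hparseval (b s) (a s)).sub (hR s)).congr_fun fun p => ?_)
    rw [boundedMul_apply, analysis_apply, analysis_apply, RCLike.inner_apply, inner_conj_symm]
    simp only [hχ]
    ring
  -- Of the two factors 1/s, one is absorbed by ‖b s‖ ≤ s‖u‖ and the other forms the difference
  -- quotient of a.
  have hbound : ∀ᶠ s : ℝ in 𝓝[>] 0,
      ‖((s * s : ℝ) : ℂ)⁻¹ * ((1 - expChar (-(s * s))) *
        inner ℂ (tfShift (s, 0) h) (tfShift (0, s) g))‖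
      ≤ ‖analysis v hvB‖ * ‖u‖ *
        ‖boundedMul (χ s) (hχ2 s) (analysis w hwB ((s : ℂ)⁻¹ • a s))‖ := by
    filter_upwards [self_mem_nhdsWithin] with s hs
    have hs0 : (0 : ℝ) < s := hs
    have hm : boundedMul (χ s) (hχ2 s) (analysis w hwB ((s : ℂ)⁻¹ • a s))
        = (s : ℂ)⁻¹ • boundedMul (χ s) (hχ2 s) (analysis w hwB (a s)) := by
      ext p
      rw [boundedMul_apply, map_smul, lp.coeFn_smul, lp.coeFn_smul, Pi.smul_apply, Pi.smul_apply,
        boundedMul_apply, smul_eq_mul, smul_eq_mul]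
      ring
    rw [hm, ← hLR, norm_mul, norm_smul, norm_inv, norm_inv, Complex.norm_real, Complex.norm_real,
      Real.norm_of_nonneg hs0.le, Real.norm_of_nonneg (by positivity)]
    have h1 : ‖b s‖ ≤ s * ‖u‖ := by
      simpa [abs_of_pos hs0] using norm_translate_sub_le hu s
    set m := boundedMul (χ s) (hχ2 s) (analysis w hwB (a s))
    calc (s * s)⁻¹ * ‖inner ℂ (analysis v hvB (b s)) m‖
        ≤ (s * s)⁻¹ * ((‖analysis v hvB‖ * (s * ‖u‖)) * ‖m‖) := by
          gcongr
          refine (norm_inner_le_norm _ _).trans ?_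
          gcongr
          exact (ContinuousLinearMap.le_opNorm _ _).trans (by gcongr)
      _ = _ := by field_simp
  have hlim0 : Tendsto (fun s : ℝ => ((s * s : ℝ) : ℂ)⁻¹ * ((1 - expChar (-(s * s))) *
      inner ℂ (tfShift (s, 0) h) (tfShift (0, s) g))) (𝓝[>] 0) (𝓝 0) := by
    have hmul := tendsto_norm_boundedMul hχ2 hχ0
      (((analysis w hwB).continuous.tendsto _).comp (tendsto_modulation_sub hg))
    refine squeeze_zero_norm' hbound ?_
    have h0 := hmul.const_mul (‖analysis v hvB‖ * ‖u‖)
    rw [mul_zero] at h0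
    exact h0
  have hid : Tendsto (fun s : ℝ => s) (𝓝[>] 0) (𝓝 0) := nhdsWithin_le_nhds
  have hUg : Tendsto (fun s : ℝ => tfShift (0, s) g) (𝓝[>] 0) (𝓝 g) := by
    have h1 := ((Complex.continuous_ofReal.tendsto 0).comp hid).smul (tendsto_modulation_sub hg)
    have h2 : Tendsto a (𝓝[>] 0) (𝓝 0) := by
      rw [Complex.ofReal_zero, zero_smul] at h1
      refine h1.congr' ?_
      filter_upwards [self_mem_nhdsWithin] with s hs
      have : (s : ℂ) ≠ 0 := Complex.ofReal_ne_zero.mpr (ne_of_gt hs)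
      simp [smul_smul, this, ha]
    simpa [ha] using h2.add_const g
  have hVh : Tendsto (fun s : ℝ => tfShift (s, 0) h) (𝓝[>] 0) (𝓝 h) := by
    rw [tendsto_iff_norm_sub_tendsto_zero]
    refine squeeze_zero (fun s => norm_nonneg _) (fun s => norm_translate_sub_le hu s) ?_
    simpa using hid.abs.mul_const ‖u‖
  have hlim1 : Tendsto (fun s : ℝ => ((s * s : ℝ) : ℂ)⁻¹ * ((1 - expChar (-(s * s))) *
      inner ℂ (tfShift (s, 0) h) (tfShift (0, s) g))) (𝓝[>] 0)
      (𝓝 (2 * Real.pi * Complex.I * 1)) := by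
    have hinner : Tendsto (fun s : ℝ => (inner ℂ (tfShift (s, 0) h) (tfShift (0, s) g) : ℂ))
        (𝓝[>] 0) (𝓝 1) := by
      have h1 : inner ℂ h g = (1 : ℂ) := by
        have h0 : w 0 = h := by
          simpa [hw, latticeShift_eq, ← Prod.zero_eq_mk] using tfShift_zero h
        simpa [h0] using hhg 0
      simpa [h1] using hVh.inner (𝕜 := ℂ) hUg
    have hneg : Tendsto (fun s : ℝ => -(s * s)) (𝓝[>] 0) (𝓝[≠] 0) := by
      refine tendsto_nhdsWithin_iff.mpr ⟨by simpa using (hid.mul hid).neg, ?_⟩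
      filter_upwards [self_mem_nhdsWithin] with s hs
      have hs0 : (0 : ℝ) < s := hs
      simp [hs0.ne']
    -- With increment −s², the slope of the character at 0 is exactly (1 − e^{−2πis²})/s².
    have hslope := hasDerivAt_expChar_zero.tendsto_slope_zero.comp hneg
    refine (hslope.mul hinner).congr fun s => ?_
    simp only [Function.comp_apply, zero_add, expChar_zero, Complex.real_smul]
    push_cast
    ring
  have := tendsto_nhds_unique hlim0 hlim1
  simp [Real.pi_ne_zero] at this

/-- The weak derivative depends on its value only up to almost everywhere equality. -/
theorem IsNabla2.congr_right {f u u' : ℝ → ℂ} (h : IsNabla2 f u) (hu : u =ᵐ[volume] u') :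
    IsNabla2 f u' := by
  refine ⟨h.1, fun x => ?_, fun φ hφ hc => ?_⟩
  · obtain ⟨s, hs, hi⟩ := h.2.1 x
    exact ⟨s, hs, hi.congr_fun_ae (ae_restrict_of_ae hu)⟩
  · rw [h.2.2 φ hφ hc]
    congr 1
    refine integral_congr_ae ?_
    filter_upwards [hu] with t ht
    rw [ht]

end BalianLow

end

theorem theorem3p3 (g h : BalianLow.L2)
    (hgen : BalianLow.IsS0Generator g)
    (hriesz : BalianLow.IsGaborRieszBasis g)
    (hdual : BalianLow.IsCanonicalDual g h) :
    ¬ BalianLow.MemS0 (BalianLow.nabla1 g) ∨ ¬ BalianLow.Nabla2MemS0 h := by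
  refine not_and_or.mp fun ⟨hg, u, hu, hmem, _⟩ => ?_
  -- Only the L² parts of the two S₀ memberships enter; u is replaced by its L² class.
  exact hriesz.not_isNabla2 hdual hg.1 (hu.congr_right hmem.coeFn_toLp.symm)
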